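/- A *positively ordered monoid* is a commutative monoid $S$ (written additively) with a partial order such that $0\le x$ for all $x\in S$, and $x+z\le y+z$ whenever $x\le y$. For $x,y$ in a partially ordered set, write $x\ll y$ if for every increasing sequence $(y_n)_n$ whose supremum exists and satisfies $y\le\sup_n y_n$ there is $n$ with $x\le y_n$. A *$\mathrm{Cu}$-semigroup* is a positively ordered monoid $S$ such that increasing sequences have suprema, every element is the supremum of a $\ll$-increasing sequence, $x'\ll x$ and $y'\ll y$ imply $x'+y'\ll x+y$, and $\sup_n(x_n+y_n)=\sup_n x_n+\sup_n y_n$ for all increasing sequences $(x_n)_n,(y_n)_n$. Consider the following axioms, with all variables ranging over $S$: * (O5) If $r+s\le t$, $r'\ll r$ and $s'\ll s$, then there is $u$ with $r'+u\le t\le r+u$ and $s'\ll u$. * (O6) If $x'\ll x\le y+z$, then there are $e,f$ with $x'\le e+f$, $e\le x,y$ and $f\le x,z$. * (O7) If $x_1'\ll x_1\le w$ and $x_2'\ll x_2\le w$, then there is $x$ with $x_1'\ll x$, $x_2'\ll x$, $x\le w$ and $x\le x_1+x_2$. * (O8) If $w+w=w$, $x+y\ll z+w$, $x'\ll x$ and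 $y'\ll y$, then there are $z_1,z_2$ with $z_1+z_2\ll z$, $x'\ll z_1+w$, $z_1\ll x+w$, $y'\ll z_2+w$ and $z_2\ll y+w$. An *ideal* of $S$ is a submonoid $I\subseteq S$ that is closed under suprema of increasing sequences and downward hereditary ($x\le y\in I$ implies $x\in I$); it carries the induced addition and order. For $x,y\in S$ write $x\le_I y$ if $x\le y+w$ for some $w\in I$, and $x\sim_I y$ if $x\le_I y$ and $y\le_I x$. Then $S/I$ denotes the set of $\sim_I$-classes with the addition induced from $S$ and the partial order induced by $\le_I$. Both $I$ and $S/I$ are again $\mathrm{Cu}$-semigroups. Let $\mathbb N=\{0,1,2,\dots\}$. Write $x<_s y$ if $(k+1)x\le ky$ for some $k\in\mathbb N$. For $m,n\in\mathbb N$, a $\mathrm{Cu}$-semigroup is *$(m,n)$-pure* if * whenever $x<_s y_j$ for $j=0,\dots,m$, then $x\le y_0+\dots+y_m$; and * for all $k\in\mathbb N$ and all $x'\ll x$ there is $y$ with $ky\le x$ and $x'\le (k+1)(n+1)y$. **Theorem.** Let $S$ be a $\mathrm{Cu}$-semigroup satisfying (O5)–(O8), and let $I$ be an ideal in $S$. Then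 $S$ is $(m,n)$-pure for some $m,n\in\mathbb N$ if and only if $I$ is $(m',n')$-pure for some $m',n'\in\mathbb N$ and $S/I$ is $(m'',n'')$-pure for some $m'',n''\in\mathbb N$. -/

import Mathlib

open scoped BigOperators

/-- The (sequential) way-below relation `x ≪ y`: whenever an increasing sequence has a supremum
`s` with `y ≤ s`, some member of the sequence lies above `x`. -/
def WayBelow {S : Type*} [PartialOrder S] (x y : S) : Prop :=
  ∀ (a : ℕ → S) (s : S), Monotone a → IsLUB (Set.range a) s → y ≤ s → ∃ n, x ≤ a n

/-- A `Cu`-semigroup: a commutative monoid with a compatible partial order in which every element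
is positive, satisfying the axioms (O1)-(O4). -/
class CuSemigroup (S : Type*) [AddCommMonoid S] [PartialOrder S] : Prop
    extends IsOrderedAddMonoid S where
  zero_le' : ∀ x : S, 0 ≤ x
  /-- (O1) increasing sequences have suprema -/
  exists_isLUB : ∀ a : ℕ → S, Monotone a → ∃ s, IsLUB (Set.range a) s
  /-- (O2) every element is the supremum of a `≪`-increasing sequence -/
  exists_wayBelow_seq : ∀ x : S, ∃ a : ℕ → S,
    (∀ n, WayBelow (a n) (a (n + 1))) ∧ IsLUB (Set.range a) x
  /-- (O3) addition is compatible with `≪` -/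
  wayBelow_add : ∀ x' x y' y : S, WayBelow x' x → WayBelow y' y → WayBelow (x' + y') (x + y)
  /-- (O4) addition is compatible with suprema of increasing sequences -/
  isLUB_add : ∀ (a b : ℕ → S) (x y : S), Monotone a → Monotone b →
    IsLUB (Set.range a) x → IsLUB (Set.range b) y → IsLUB (Set.range fun n => a n + b n) (x + y)

section Axioms

variable (S : Type*) [AddCommMonoid S] [PartialOrder S]

/-- (O5), almost algebraic order. -/
def AxiomO5 : Prop :=
  ∀ r' r s' s t : S, r + s ≤ t → WayBelow r' r → WayBelow s' s →
    ∃ u : S, r' + u ≤ t ∧ t ≤ r + u ∧ WayBelow s' u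

/-- (O6), almost Riesz decomposition. -/
def AxiomO6 : Prop :=
  ∀ x' x y z : S, WayBelow x' x → x ≤ y + z →
    ∃ e f : S, x' ≤ e + f ∧ e ≤ x ∧ e ≤ y ∧ f ≤ x ∧ f ≤ z

/-- (O7), almost Riesz-type upper bounds. -/
def AxiomO7 : Prop :=
  ∀ x₁' x₁ x₂' x₂ w : S, WayBelow x₁' x₁ → x₁ ≤ w → WayBelow x₂' x₂ → x₂ ≤ w →
    ∃ x : S, WayBelow x₁' x ∧ WayBelow x₂' x ∧ x ≤ w ∧ x ≤ x₁ + x₂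

/-- (O8), lifting of almost decompositions modulo an idempotent element. -/
def AxiomO8 : Prop :=
  ∀ x' x y' y z w : S, w + w = w → WayBelow (x + y) (z + w) → WayBelow x' x → WayBelow y' y →
    ∃ z₁ z₂ : S, WayBelow (z₁ + z₂) z ∧
      WayBelow x' (z₁ + w) ∧ WayBelow z₁ (x + w) ∧
      WayBelow y' (z₂ + w) ∧ WayBelow z₂ (y + w)

end Axioms

section Pureness

/-- The relation `x <ₛ y`. -/
def StablyBelow {S : Type*} [AddCommMonoid S] [PartialOrder S] (x y : S) : Prop :=
  ∃ n : ℕ, (n + 1) • x ≤ n • y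

variable (S : Type*) [AddCommMonoid S] [PartialOrder S]

/-- `m`-comparison. -/
def HasComparison (m : ℕ) : Prop :=
  ∀ (x : S) (y : Fin (m + 1) → S), (∀ j, StablyBelow x (y j)) → x ≤ ∑ j, y j

/-- `n`-almost divisibility. -/
def IsAlmostDivisible (n : ℕ) : Prop :=
  ∀ (k : ℕ) (x' x : S), WayBelow x' x → ∃ y : S, k • y ≤ x ∧ x' ≤ ((k + 1) * (n + 1)) • y

/-- `(m, n)`-pureness. -/
def IsPureMN (m n : ℕ) : Prop :=
  HasComparison S m ∧ IsAlmostDivisible S n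

end Pureness

/-- An ideal of a `Cu`-semigroup: a submonoid that is downward hereditary and closed under suprema
of increasing sequences. As a type, it carries the addition and the order induced from `S`. -/
structure CuIdeal (S : Type*) [AddCommMonoid S] [PartialOrder S] extends AddSubmonoid S where
  mem_of_le : ∀ x y : S, x ≤ y → y ∈ carrier → x ∈ carrier
  mem_of_isLUB : ∀ (a : ℕ → S) (s : S), Monotone a → (∀ n, a n ∈ carrier) →
    IsLUB (Set.range a) s → s ∈ carrier

namespace CuIdeal

section Quotient

variable {S : Type*} [AddCommMonoid S] [PartialOrder S]

/-- The relation `x ≤_I y`. -/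
def Le (I : CuIdeal S) (x y : S) : Prop :=
  ∃ w ∈ I.toAddSubmonoid, x ≤ y + w

theorem Le.refl (I : CuIdeal S) (x : S) : I.Le x x :=
  ⟨0, I.zero_mem, by simp⟩

variable [IsOrderedAddMonoid S]

theorem Le.trans {I : CuIdeal S} {x y z : S} (h : I.Le x y) (h' : I.Le y z) : I.Le x z := by
  obtain ⟨v, hv, h⟩ := h
  obtain ⟨w, hw, h'⟩ := h'
  refine ⟨w + v, I.add_mem hw hv, h.trans ?_⟩
  rw [← add_assoc]
  gcongr

theorem Le.add {I : CuIdeal S} {x y x' y' : S} (h : I.Le x y) (h' : I.Le x' y') :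
    I.Le (x + x') (y + y') := by
  obtain ⟨v, hv, h⟩ := h
  obtain ⟨w, hw, h'⟩ := h'
  refine ⟨v + w, I.add_mem hv hw, ?_⟩
  rw [add_add_add_comm]
  gcongr

/-- The congruence `x ∼_I y`, that is, `x ≤_I y` and `y ≤_I x`. -/
def con (I : CuIdeal S) : AddCon S where
  r x y := I.Le x y ∧ I.Le y x
  iseqv :=
    { refl := fun x => ⟨Le.refl I x, Le.refl I x⟩
      symm := fun h => ⟨h.2, h.1⟩
      trans := fun h h' => ⟨h.1.trans h'.1, h'.2.trans h.2⟩ }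
  add' h h' := ⟨h.1.add h'.1, h.2.add h'.2⟩

/-- The quotient `S/I`, the set of `∼_I`-classes, with the addition induced from `S`. -/
abbrev Quot (I : CuIdeal S) : Type _ := I.con.Quotient

/-- The partial order on `S/I` induced by `≤_I`. -/
instance instPartialOrderQuot (I : CuIdeal S) : PartialOrder I.Quot where
  le p q := Quotient.liftOn₂' p q I.Le fun _ _ _ _ h h' =>
    propext ⟨fun H => (h.2.trans H).trans h'.1, fun H => (h.1.trans H).trans h'.2⟩
  le_refl p := Quotient.inductionOn' p fun x => Le.refl I x
  le_trans p q r := Quotient.inductionOn₃' p q r fun _ _ _ h h' => Le.trans h h'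
  le_antisymm p q := Quotient.inductionOn₂' p q fun _ _ h h' => Quotient.sound' ⟨h, h'⟩

end Quotient

end CuIdeal

/-!
The forward direction is formal: an ideal is closed under the witnesses that pureness produces, the
quotient map preserves suprema of increasing sequences, and countably many elements of an ideal lie
below one idempotent element of it (`CuIdeal.exists_idempotent`), which absorbs all error terms of
relations modulo `I`.

Conversely, let `I` be `(m', n')`-pure and `S/I` be `(m'', n'')`-pure. The two halves of pureness
are extended independently of each other. Both use that an element of `I` below `k • y` is, up to
`≪`, below `k • z` for some `z ≤ y` in `I` (`CuIdeal.exists_mem_le_nsmul`, from (O6) and (O7)).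

*Comparison* (`CuIdeal.hasComparison`). If `x <ₛ y_j` for `m' + m'' + 2` elements `y_j`, then
comparison in `S/I` bounds `x` by the sum of the first `m'' + 1` of them plus some `w ∈ I`. By (O6)
the part of `x` under `w` is an element `f ≤ x` of `I`; each remaining `y_j` can be replaced by an
element of `I` that still stably dominates `f`, so that comparison in `I` applies.

*Divisibility* (`CuIdeal.isAlmostDivisible`). Divide `x` by `2k` modulo `I`. By (O8) the
divisor lifts to an actual `v` with `2k • v ≤ x` (`exists_nsmul_le_of_nsmul_le_add`). Now (O5)
provides a complement `c` of `k • v` in `x`; as there were `2k` copies of `v`, this `c` still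
dominates `k • v`, whence `x ≤ 2 • c`. The part of `x` not controlled by `v` is in `I` and below
`2 • c`, hence below `2 • z` for some `z ≤ c` in `I`. Dividing `z` by `k` within `I` gives `u`, and
`v + u` is the required divisor: `k • (v + u) ≤ k • v + c ≤ x`.
-/

/-! ### The way-below relation -/

section WayBelow

variable {S : Type*} [PartialOrder S]

theorem WayBelow.le {x y : S} (h : WayBelow x y) : x ≤ y := by
  obtain ⟨_, hn⟩ := h (fun _ => y) y monotone_const (by simp) le_rfl
  exact hn

theorem WayBelow.trans_le {x y z : S} (h : WayBelow x y) (h' : y ≤ z) : WayBelow x z :=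
  fun a s ha hs hz => h a s ha hs (h'.trans hz)

theorem WayBelow.of_le {x y z : S} (h : x ≤ y) (h' : WayBelow y z) : WayBelow x z :=
  fun a s ha hs hz => (h' a s ha hs hz).imp fun _ hn => h.trans hn

end WayBelow

namespace CuSemigroup

variable {S : Type*} [AddCommMonoid S] [PartialOrder S] [CuSemigroup S]

/-- Every element is the supremum of an increasing sequence of elements way below it. -/
theorem exists_seq (x : S) :
    ∃ a : ℕ → S, Monotone a ∧ (∀ n, WayBelow (a n) x) ∧ IsLUB (Set.range a) x := by
  obtain ⟨a, ha, hx⟩ := exists_wayBelow_seq x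
  exact ⟨a, monotone_nat_of_le_succ fun n => (ha n).le,
    fun n => (ha n).trans_le (hx.1 ⟨n + 1, rfl⟩), hx⟩

theorem exists_between {x' x : S} (h : WayBelow x' x) : ∃ y, WayBelow x' y ∧ WayBelow y x := by
  obtain ⟨a, ha, hx⟩ := exists_wayBelow_seq x
  have hm : Monotone a := monotone_nat_of_le_succ fun n => (ha n).le
  obtain ⟨n, hn⟩ := h a x hm hx le_rfl
  exact ⟨a (n + 1), (ha n).of_le hn, (ha (n + 1)).trans_le (hx.1 ⟨n + 2, rfl⟩)⟩

theorem le_of_forall_wayBelow {x y : S} (h : ∀ x', WayBelow x' x → x' ≤ y) : x ≤ y := by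
  obtain ⟨a, _, ha, hx⟩ := exists_seq x
  exact hx.2 (by rintro _ ⟨n, rfl⟩; exact h _ (ha n))

theorem exists_le_add_of_wayBelow_add {x y z : S} (h : WayBelow x (y + z)) :
    ∃ y' z', WayBelow y' y ∧ WayBelow z' z ∧ x ≤ y' + z' := by
  obtain ⟨a, ham, ha, hy⟩ := exists_seq y
  obtain ⟨b, hbm, hb, hz⟩ := exists_seq z
  obtain ⟨n, hn⟩ := h _ _ (fun i j hij => add_le_add (ham hij) (hbm hij))
    (isLUB_add a b y z ham hbm hy hz) le_rfl
  exact ⟨a n, b n, ha n, hb n, hn⟩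

theorem isLUB_nsmul {a : ℕ → S} {x : S} (ha : Monotone a) (hx : IsLUB (Set.range a) x) (k : ℕ) :
    IsLUB (Set.range fun n => k • a n) (k • x) := by
  induction k with
  | zero => simp
  | succ k ih =>
    simp only [succ_nsmul]
    exact isLUB_add _ _ _ _ (fun i j hij => nsmul_le_nsmul_right (ha hij) k) ha ih hx

theorem isLUB_add_const {a : ℕ → S} {x : S} (ha : Monotone a) (hx : IsLUB (Set.range a) x)
    (w : S) : IsLUB (Set.range fun n => a n + w) (x + w) :=
  isLUB_add _ _ _ _ ha monotone_const hx (by simp)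

theorem exists_le_nsmul_add_of_wayBelow {x y w : S} {k : ℕ} (h : WayBelow x (k • y + w)) :
    ∃ y', WayBelow y' y ∧ x ≤ k • y' + w := by
  obtain ⟨a, ham, ha, hy⟩ := exists_seq y
  have hm : Monotone fun n => k • a n := fun i j hij => nsmul_le_nsmul_right (ham hij) k
  obtain ⟨n, hn⟩ := h _ _ (fun i j hij => add_le_add_left (hm hij) w)
    (isLUB_add_const hm (isLUB_nsmul ham hy k) w) le_rfl
  exact ⟨a n, ha n, hn⟩

theorem wayBelow_zero (x : S) : WayBelow 0 x := fun _ _ _ _ _ => ⟨0, zero_le' _⟩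

theorem wayBelow_nsmul {x' x : S} (h : WayBelow x' x) (k : ℕ) : WayBelow (k • x') (k • x) := by
  induction k with
  | zero => simpa using wayBelow_zero (0 : S)
  | succ k ih =>
    simp only [succ_nsmul]
    exact wayBelow_add _ _ _ _ ih h

theorem le_add_right' (x y : S) : x ≤ x + y := by
  simpa using add_le_add_right (zero_le' y) x

theorem le_add_left' (x y : S) : x ≤ y + x := by
  rw [add_comm]; exact le_add_right' x y

theorem nsmul_mono_left (x : S) {k l : ℕ} (h : k ≤ l) : k • x ≤ l • x := by
  obtain ⟨d, rfl⟩ := Nat.exists_eq_add_of_le h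
  rw [add_nsmul]
  exact le_add_right' _ _

theorem nsmul_le_of_add_self {w : S} (h : w + w = w) (k : ℕ) : k • w ≤ w := by
  induction k with
  | zero => simpa using zero_le' w
  | succ k ih =>
    rw [succ_nsmul]
    exact (add_le_add_left ih w).trans h.le

/-- (O8) lifts a divisor modulo an idempotent: if `k • y ≤ x + w`, then up to `≪` the element `y`
agrees modulo `w` with some `v` that satisfies `k • v ≤ x` exactly. -/
theorem exists_nsmul_le_of_nsmul_le_add (hO6 : AxiomO6 S) (hO8 : AxiomO8 S) {w : S}
    (hw : w + w = w) (k : ℕ) : ∀ {y' y x : S}, WayBelow y' y → k • y ≤ x + w →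
      ∃ v, k • v ≤ x ∧ y' ≤ v + w := by
  induction k with
  | zero =>
    intro y' y x _ _
    exact ⟨y', by simpa using zero_le' x, le_add_right' _ _⟩
  | succ k ih =>
    intro y' y x hy h
    obtain ⟨y₃, hy, hy₃⟩ := exists_between hy
    obtain ⟨y₂, hy, hy₂⟩ := exists_between hy
    obtain ⟨y₁, hy, hy₁⟩ := exists_between hy
    obtain ⟨y₀, hy, hy₀⟩ := exists_between hy
    rw [succ_nsmul] at h
    obtain ⟨z₁, z₂, hz, hz₁, -, hz₂, -⟩ := hO8 _ _ _ _ _ _ hw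
      ((wayBelow_add _ _ _ _ (wayBelow_nsmul hy₃ k) hy₃).trans_le h) (wayBelow_nsmul hy₂ k) hy₂
    obtain ⟨v₁, hv₁, hyv⟩ := ih hy₁ hz₁.le
    -- A common lower bound `v` of `v₁` and `z₂` is found by splitting `y₁` along `v₁ + w`,
    -- and the first part, which is still below `y₁`, along `z₂ + w`.
    obtain ⟨e, f, hef, hey, hev, -, hfw⟩ := hO6 _ _ _ _ hy₀ hyv
    obtain ⟨e', f', he', hf', hyef⟩ := exists_le_add_of_wayBelow_add (hy.trans_le hef)
    obtain ⟨v, g, hvg, hve, hvz, -, hgw⟩ :=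
      hO6 _ _ _ _ he' (hey.trans (hy₁.le.trans hz₂.le))
    refine ⟨v, ?_, ?_⟩
    · rw [succ_nsmul]
      exact (add_le_add ((nsmul_le_nsmul_right (hve.trans hev) k).trans hv₁) hvz).trans hz.le
    · calc y' ≤ e' + f' := hyef
        _ ≤ (v + w) + w := add_le_add (hvg.trans (add_le_add_right hgw v)) (hf'.le.trans hfw)
        _ = v + w := by rw [add_assoc, hw]

end CuSemigroup

open CuSemigroup

namespace CuIdeal

variable {S : Type*} [AddCommMonoid S] [PartialOrder S] (I : CuIdeal S)

/-! ### Ideals -/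

theorem mem_of_le' {x y : S} (h : x ≤ y) (hy : y ∈ I.toAddSubmonoid) : x ∈ I.toAddSubmonoid :=
  I.mem_of_le x y h hy

theorem hasComparison_coe {m : ℕ} (h : HasComparison S m) : HasComparison I.toAddSubmonoid m := by
  intro x y hxy
  have : (x : S) ≤ ∑ j, (y j : S) := h x (fun j => y j) fun j => (hxy j).imp fun k hk => by
    exact_mod_cast hk
  exact_mod_cast this

variable [CuSemigroup S]

/-- Countably many elements of an ideal are dominated by one idempotent element of the ideal. -/
theorem exists_idempotent (w : ℕ → S) (hw : ∀ n, w n ∈ I.toAddSubmonoid) :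
    ∃ v ∈ I.toAddSubmonoid, v + v = v ∧ ∀ n, w n ≤ v := by
  let W : ℕ → S := fun n => ∑ i ∈ Finset.range n, w i
  have hW : Monotone W := monotone_nat_of_le_succ fun n => by
    simp only [W, Finset.sum_range_succ]
    exact le_add_right' _ _
  have ha : Monotone fun n => n • W n := fun i j hij =>
    (nsmul_mono_left _ hij).trans (nsmul_le_nsmul_right (hW hij) j)
  obtain ⟨v, hv⟩ := exists_isLUB _ ha
  refine ⟨v, I.mem_of_isLUB _ v ha (fun n => ?_) hv, ?_, fun n => ?_⟩
  · exact I.nsmul_mem (I.sum_mem fun i _ => hw i) n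
  · refine le_antisymm ((isLUB_add _ _ _ _ ha ha hv hv).2 ?_) (le_add_right' _ _)
    rintro _ ⟨n, rfl⟩
    refine le_trans ?_ (hv.1 ⟨n + n, rfl⟩)
    simp only [← add_nsmul]
    exact nsmul_le_nsmul_right (hW (Nat.le_add_right n n)) _
  · refine le_trans ?_ (hv.1 ⟨n + 1, rfl⟩)
    refine le_trans ?_ (nsmul_mono_left _ (Nat.le_add_left 1 n))
    simp only [one_nsmul, W, Finset.sum_range_succ]
    exact le_add_left' _ _

/-- Suprema computed in an ideal are suprema in the ambient semigroup. -/
theorem isLUB_coe {a : ℕ → I.toAddSubmonoid} {s : I.toAddSubmonoid} (ha : Monotone a)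
    (hs : IsLUB (Set.range a) s) : IsLUB (Set.range fun n => (a n : S)) (s : S) := by
  have ham : Monotone fun n => (a n : S) := fun i j hij => ha hij
  obtain ⟨t, ht⟩ := exists_isLUB _ ham
  have htI : t ∈ I.toAddSubmonoid := I.mem_of_isLUB _ t ham (fun n => (a n).2) ht
  have : s = ⟨t, htI⟩ := le_antisymm
    (hs.2 (by rintro _ ⟨n, rfl⟩; exact ht.1 ⟨n, rfl⟩))
    (ht.2 (by rintro _ ⟨n, rfl⟩; exact hs.1 ⟨n, rfl⟩))
  rw [this]
  exact ht

/-- The way-below relation of an ideal is the one induced from the ambient semigroup. -/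
theorem wayBelow_coe_iff {x y : I.toAddSubmonoid} : WayBelow (x : S) (y : S) ↔ WayBelow x y := by
  constructor
  · intro h a s ha hs hy
    exact h _ _ (fun i j hij => ha hij) (I.isLUB_coe ha hs) hy
  · intro h
    obtain ⟨a, ham, ha, hy⟩ := exists_seq (y : S)
    obtain ⟨n, hn⟩ := h (fun n => ⟨a n, I.mem_of_le' (ha n).le y.2⟩) y (fun i j hij => ham hij)
      ⟨by rintro _ ⟨n, rfl⟩; exact hy.1 ⟨n, rfl⟩,
        fun b hb => hy.2 (by rintro _ ⟨n, rfl⟩; exact hb ⟨n, rfl⟩)⟩ le_rfl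
    exact (ha n).of_le hn

/-- If an element of the ideal lies below `k • y`, then up to `≪` it lies below `k • z` for some
`z ≤ y` in the ideal: (O6) splits it into `k` pieces below `y`, and (O7) gives these a common upper
bound. -/
theorem exists_mem_le_nsmul (hO6 : AxiomO6 S) (hO7 : AxiomO7 S) (k : ℕ) :
    ∀ {f' f y : S}, WayBelow f' f → f ∈ I.toAddSubmonoid → f ≤ k • y →
      ∃ z ∈ I.toAddSubmonoid, z ≤ y ∧ f' ≤ k • z := by
  induction k with
  | zero =>
    intro f' f y hf _ h
    exact ⟨0, I.zero_mem, zero_le' y, by simpa using hf.le.trans h⟩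
  | succ k ih =>
    intro f' f y hf hfI h
    rw [succ_nsmul] at h
    obtain ⟨f₁, hf, hf₁⟩ := exists_between hf
    obtain ⟨e, g, heg, hef, hey, hgf, hgy⟩ := hO6 _ _ _ _ hf₁ h
    obtain ⟨e', g', he', hg', hfeg⟩ := exists_le_add_of_wayBelow_add (hf.trans_le heg)
    obtain ⟨e₁, he₁', he₁⟩ := exists_between he'
    obtain ⟨z₁, hz₁I, hz₁y, hez₁⟩ := ih he₁ (I.mem_of_le' hef hfI) hey
    obtain ⟨z₁', hz₁', hez⟩ := exists_le_nsmul_add_of_wayBelow (w := 0)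
      (he₁'.trans_le (hez₁.trans (le_add_right' _ _)))
    obtain ⟨z, hz₁z, hgz, hzy, hz⟩ := hO7 _ _ _ _ _ hz₁' hz₁y hg' hgy
    refine ⟨z, I.mem_of_le' hz (I.add_mem hz₁I (I.mem_of_le' hgf hfI)), hzy, ?_⟩
    rw [add_zero] at hez
    rw [succ_nsmul]
    exact hfeg.trans (add_le_add (hez.trans (nsmul_le_nsmul_right hz₁z.le k)) hgz.le)

/-! ### The quotient by an ideal -/

/-- The quotient map `S → S/I`, as an additive homomorphism. -/
def quotMk : S →+ I.Quot := I.con.mk'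

theorem quotMk_surjective : Function.Surjective I.quotMk := Quotient.mk''_surjective

theorem quotMk_le_quotMk {x y : S} : I.quotMk x ≤ I.quotMk y ↔
    ∃ w ∈ I.toAddSubmonoid, x ≤ y + w := Iff.rfl

theorem quotMk_mono {x y : S} (h : x ≤ y) : I.quotMk x ≤ I.quotMk y :=
  I.quotMk_le_quotMk.2 ⟨0, I.zero_mem, by simpa using h⟩

/-- Adding elements of the ideal does not change the class. -/
theorem quotMk_add_of_mem (x : S) {w : S} (hw : w ∈ I.toAddSubmonoid) :
    I.quotMk (x + w) = I.quotMk x :=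
  le_antisymm (I.quotMk_le_quotMk.2 ⟨w, hw, le_rfl⟩) (I.quotMk_mono (le_add_right' _ _))

/-- The quotient map preserves suprema of sequences. -/
theorem isLUB_quotMk {a : ℕ → S} {x : S} (hx : IsLUB (Set.range a) x) :
    IsLUB (Set.range fun n => I.quotMk (a n)) (I.quotMk x) := by
  refine ⟨by rintro _ ⟨n, rfl⟩; exact I.quotMk_mono (hx.1 ⟨n, rfl⟩), fun q hq => ?_⟩
  obtain ⟨y, rfl⟩ := I.quotMk_surjective q
  choose w hwI hw using fun n => I.quotMk_le_quotMk.1 (hq ⟨n, rfl⟩)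
  obtain ⟨v, hvI, -, hv⟩ := I.exists_idempotent w hwI
  refine I.quotMk_le_quotMk.2 ⟨v, hvI, hx.2 ?_⟩
  rintro _ ⟨n, rfl⟩
  exact (hw n).trans (add_le_add_right (hv n) y)

/-- Increasing sequences in the quotient lift to increasing sequences. -/
theorem exists_monotone_lift {q : ℕ → I.Quot} (hq : Monotone q) :
    ∃ a : ℕ → S, Monotone a ∧ ∀ n, I.quotMk (a n) = q n := by
  choose b hb using fun n => I.quotMk_surjective (q n)
  have hle : ∀ n, I.quotMk (b n) ≤ I.quotMk (b (n + 1)) := fun n => by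
    rw [hb, hb]; exact hq n.le_succ
  choose w hwI hw using fun n => I.quotMk_le_quotMk.1 (hle n)
  obtain ⟨v, hvI, hvv, hv⟩ := I.exists_idempotent w hwI
  refine ⟨fun n => b n + v, monotone_nat_of_le_succ fun n => ?_, fun n => ?_⟩
  · calc b n + v ≤ (b (n + 1) + v) + v :=
          add_le_add_left ((hw n).trans (add_le_add_right (hv n) _)) v
      _ = b (n + 1) + v := by rw [add_assoc, hvv]
  · rw [I.quotMk_add_of_mem _ hvI, hb]

theorem wayBelow_quotMk {x' x : S} (h : WayBelow x' x) : WayBelow (I.quotMk x') (I.quotMk x) := by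
  intro q s hq hs hx
  obtain ⟨a, ha, haq⟩ := I.exists_monotone_lift hq
  obtain rfl : (fun n => I.quotMk (a n)) = q := funext haq
  obtain ⟨b, hb⟩ := exists_isLUB a ha
  rw [hs.unique (I.isLUB_quotMk hb)] at hx
  obtain ⟨w, hwI, hw⟩ := I.quotMk_le_quotMk.1 hx
  obtain ⟨n, hn⟩ := h _ _ (fun i j hij => add_le_add_left (ha hij) w) (isLUB_add_const ha hb w) hw
  exact ⟨n, I.quotMk_le_quotMk.2 ⟨w, hwI, hn⟩⟩

/-! ### Pureness of ideals and quotients -/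

theorem isAlmostDivisible_coe {n : ℕ} (h : IsAlmostDivisible S n) :
    IsAlmostDivisible I.toAddSubmonoid n := by
  intro k x' x hx
  -- For `k = 0` the divisor found in `S` need not belong to the ideal, but `x` itself will do.
  rcases Nat.eq_zero_or_pos k with rfl | hk
  · refine ⟨x, by rw [zero_nsmul]; exact zero_le' (x : S), ?_⟩
    have h1 : (x : S) ≤ ((0 + 1) * (n + 1)) • (x : S) := by
      simpa using nsmul_mono_left (x : S) (Nat.le_add_left 1 n)
    exact (I.wayBelow_coe_iff.2 hx).le.trans h1
  · obtain ⟨y, hyx, hxy⟩ := h k x' x (I.wayBelow_coe_iff.2 hx)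
    have hy : y ≤ k • y := by simpa using nsmul_mono_left y hk
    exact ⟨⟨y, I.mem_of_le' (hy.trans hyx) x.2⟩, hyx, hxy⟩

theorem hasComparison_quot {m : ℕ} (h : HasComparison S m) : HasComparison I.Quot m := by
  intro p q hpq
  obtain ⟨x, rfl⟩ := I.quotMk_surjective p
  choose y hy using fun j => I.quotMk_surjective (q j)
  obtain rfl : (fun j => I.quotMk (y j)) = q := funext hy
  choose k hk using hpq
  have hk' : ∀ j, I.quotMk ((k j + 1) • x) ≤ I.quotMk (k j • y j) := fun j => by
    simpa only [map_nsmul] using hk j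
  choose w hwI hw using fun j => I.quotMk_le_quotMk.1 (hk' j)
  obtain ⟨v, hvI, hvv, hv⟩ := I.exists_idempotent (fun _ => ∑ j, w j)
    fun _ => I.sum_mem fun j _ => hwI j
  have hwv : ∀ j, w j ≤ v := fun j => le_trans
    (Finset.single_le_sum (fun i _ => zero_le' (w i)) (Finset.mem_univ j)) (hv 0)
  -- If some `k j` vanishes, then `x` is in the ideal; otherwise `w j` is absorbed into `k j • v`.
  by_cases h0 : ∃ j, k j = 0
  · obtain ⟨j, hj⟩ := h0
    refine I.quotMk_mono (?_ : x ≤ v) |>.trans ?_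
    · have := hw j
      rw [hj] at this
      simp only [zero_add, one_nsmul, zero_nsmul] at this
      exact this.trans (hwv j)
    · rw [← map_sum]
      exact I.quotMk_le_quotMk.2 ⟨v, hvI, le_add_left' _ _⟩
  · push Not at h0
    have hx := h x (fun j => y j + v) fun j => ⟨k j, (hw j).trans ?_⟩
    · refine (I.quotMk_mono hx).trans (le_of_eq ?_)
      rw [map_sum]
      exact Finset.sum_congr rfl fun j _ => I.quotMk_add_of_mem _ hvI
    · rw [nsmul_add]
      refine add_le_add_right ((hwv j).trans ?_) _
      simpa using nsmul_mono_left v (Nat.one_le_iff_ne_zero.2 (h0 j))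

theorem isAlmostDivisible_quot {n : ℕ} (h : IsAlmostDivisible S n) :
    IsAlmostDivisible I.Quot n := by
  intro k p' p hp
  obtain ⟨x, rfl⟩ := I.quotMk_surjective p
  obtain ⟨a, ham, ha, hx⟩ := exists_seq x
  obtain ⟨i, hi⟩ := hp _ _ (fun _ _ hij => I.quotMk_mono (ham hij)) (I.isLUB_quotMk hx) le_rfl
  obtain ⟨y, hyx, hxy⟩ := h k _ _ (ha i)
  refine ⟨I.quotMk y, ?_, hi.trans ?_⟩
  · rw [← map_nsmul]
    exact I.quotMk_mono hyx
  · rw [← map_nsmul]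
    exact I.quotMk_mono hxy

/-! ### Extensions of pure semigroups -/

theorem hasComparison (hO6 : AxiomO6 S) (hO7 : AxiomO7 S) {m' m'' : ℕ}
    (hI : HasComparison I.toAddSubmonoid m') (hQ : HasComparison I.Quot m'') :
    HasComparison S ((m'' + 1) + m') := by
  intro x y hxy
  have hx := hQ (I.quotMk x) (fun j => I.quotMk (y (Fin.castAdd (m' + 1) j))) fun j =>
    (hxy (Fin.castAdd (m' + 1) j)).imp fun k hk => by
      rw [← map_nsmul, ← map_nsmul]
      exact I.quotMk_mono hk
  rw [← map_sum] at hx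
  obtain ⟨w, hwI, hw⟩ := I.quotMk_le_quotMk.1 hx
  refine le_of_forall_wayBelow fun x' hx' => ?_
  obtain ⟨x₁, hx', hx₁⟩ := exists_between hx'
  obtain ⟨e, f, hef, -, hey, hfx, hfw⟩ := hO6 _ _ _ _ hx₁ hw
  obtain ⟨e', f', he', hf', hxef⟩ := exists_le_add_of_wayBelow_add (hx'.trans_le hef)
  have hfI := I.mem_of_le' hfw hwI
  have key : ∀ j : Fin (m' + 1), ∃ z : I.toAddSubmonoid, (z : S) ≤ y (Fin.natAdd (m'' + 1) j) ∧
      StablyBelow (⟨f', I.mem_of_le' hf'.le hfI⟩ : I.toAddSubmonoid) z := fun j => by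
    obtain ⟨k, hk⟩ := hxy (Fin.natAdd (m'' + 1) j)
    obtain ⟨z, hzI, hzy, hfz⟩ := I.exists_mem_le_nsmul hO6 hO7 k (wayBelow_nsmul hf' (k + 1))
      (I.nsmul_mem hfI _) ((nsmul_le_nsmul_right hfx _).trans hk)
    exact ⟨⟨z, hzI⟩, hzy, k, hfz⟩
  choose z hzy hz using key
  have hfz : f' ≤ ∑ j, (z j : S) := by
    have : f' ≤ ((∑ j, z j : I.toAddSubmonoid) : S) := hI _ z hz
    simpa using this
  have hsum : ∑ j, y j =
      ∑ j, y (Fin.castAdd (m' + 1) j) + ∑ j : Fin (m' + 1), y (Fin.natAdd (m'' + 1) j) :=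
    Fin.sum_univ_add (a := m'' + 1) (b := m' + 1) y
  rw [hsum]
  exact hxef.trans (add_le_add (he'.le.trans hey)
    (hfz.trans (Finset.sum_le_sum fun j _ => hzy j)))

/-- Almost divisibility of the quotient lifts to divisibility up to an error term in the ideal. -/
theorem exists_nsmul_le_of_isAlmostDivisible_quot (hO6 : AxiomO6 S) (hO8 : AxiomO8 S) {n : ℕ}
    (hQ : IsAlmostDivisible I.Quot n) (k : ℕ) {x' x : S} (hx : WayBelow x' x) :
    ∃ v, ∃ w ∈ I.toAddSubmonoid, k • v ≤ x ∧ x' ≤ ((k + 1) * (n + 1)) • v + w := by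
  obtain ⟨x₁, hx', hx₁⟩ := exists_between hx
  obtain ⟨q, hqx, hxq⟩ := hQ k _ _ (I.wayBelow_quotMk hx₁)
  obtain ⟨y, rfl⟩ := I.quotMk_surjective q
  rw [← map_nsmul] at hqx hxq
  obtain ⟨w₁, hw₁I, hw₁⟩ := I.quotMk_le_quotMk.1 hqx
  obtain ⟨w₂, hw₂I, hw₂⟩ := I.quotMk_le_quotMk.1 hxq
  obtain ⟨w, hwI, hww, hw⟩ := I.exists_idempotent (fun _ => w₁ + w₂)
    fun _ => I.add_mem hw₁I hw₂I
  obtain ⟨y', hy', hxy'⟩ := exists_le_nsmul_add_of_wayBelow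
    (hx'.trans_le (hw₂.trans (add_le_add_right ((le_add_left' _ _).trans (hw 0)) _)))
  obtain ⟨v, hvx, hyv⟩ := exists_nsmul_le_of_nsmul_le_add hO6 hO8 hww k hy'
    (hw₁.trans (add_le_add_right ((le_add_right' _ _).trans (hw 0)) _))
  refine ⟨v, w, hwI, hvx, ?_⟩
  calc x' ≤ ((k + 1) * (n + 1)) • y' + w := hxy'
    _ ≤ ((k + 1) * (n + 1)) • (v + w) + w := add_le_add_left (nsmul_le_nsmul_right hyv _) w
    _ ≤ (((k + 1) * (n + 1)) • v + w) + w := by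
      rw [nsmul_add]
      exact add_le_add_left (add_le_add_right (nsmul_le_of_add_self hww _) _) w
    _ = ((k + 1) * (n + 1)) • v + w := by rw [add_assoc, hww]

theorem isAlmostDivisible (hO5 : AxiomO5 S) (hO6 : AxiomO6 S) (hO7 : AxiomO7 S)
    (hO8 : AxiomO8 S) {n' n'' : ℕ} (hI : IsAlmostDivisible I.toAddSubmonoid n')
    (hQ : IsAlmostDivisible I.Quot n'') :
    IsAlmostDivisible S (2 * (n'' + 1) + 2 * (n' + 1)) := by
  intro k x' x hx
  obtain ⟨x₃, hx, hx₃⟩ := exists_between hx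
  obtain ⟨x₂, hx, hx₂⟩ := exists_between hx
  obtain ⟨x₁, hx', hx₁⟩ := exists_between hx
  obtain ⟨v, w, hwI, hvx, hxv⟩ :=
    I.exists_nsmul_le_of_isAlmostDivisible_quot hO6 hO8 hQ (k + k) hx₃
  obtain ⟨v₀, hv₀, hxv₀⟩ := exists_le_nsmul_add_of_wayBelow (hx₂.trans_le hxv)
  obtain ⟨v₁, hv₀, hv₁⟩ := exists_between hv₀
  -- `c` is a complement in `x` of one half of the `2k` copies of `v`, and dominates the other half.
  rw [add_nsmul] at hvx
  obtain ⟨c, hcx, hxc, hvc⟩ := hO5 (k • v₀) (k • v₁) (k • v₁) (k • v) x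
    ((add_le_add_left (nsmul_le_nsmul_right hv₁.le k) _).trans hvx)
    (wayBelow_nsmul hv₀ k) (wayBelow_nsmul hv₁ k)
  have hx2c : x ≤ 2 • c := by
    rw [two_nsmul]
    exact hxc.trans (add_le_add_left hvc.le c)
  -- `f` is the part of `x` that is not controlled by `v₀`.
  obtain ⟨e, f, hef, -, hev, hfx, hfw⟩ := hO6 _ _ _ _ hx₁ hxv₀
  obtain ⟨e', f', he', hf', hxef⟩ := exists_le_add_of_wayBelow_add (hx'.trans_le hef)
  obtain ⟨f₁, hf', hf₁⟩ := exists_between hf'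
  obtain ⟨z, hzI, hzc, hfz⟩ := I.exists_mem_le_nsmul hO6 hO7 2 hf₁ (I.mem_of_le' hfw hwI)
    (hfx.trans (hx₂.le.trans (hx₃.le.trans hx2c)))
  obtain ⟨z', hz', hfz'⟩ := exists_le_nsmul_add_of_wayBelow (w := 0)
    (hf'.trans_le (hfz.trans (le_add_right' _ _)))
  rw [add_zero] at hfz'
  obtain ⟨u, huz, hzu⟩ := hI k ⟨z', I.mem_of_le' hz'.le hzI⟩ ⟨z, hzI⟩ (I.wayBelow_coe_iff.1 hz')
  have huz : k • (u : S) ≤ z := huz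
  have hzu : z' ≤ ((k + 1) * (n' + 1)) • (u : S) := hzu
  refine ⟨v₀ + u, ?_, ?_⟩
  · rw [nsmul_add]
    exact (add_le_add_right (huz.trans hzc) _).trans hcx
  · calc x' ≤ ((k + k + 1) * (n'' + 1)) • v₀ + 2 • (((k + 1) * (n' + 1)) • (u : S)) :=
          hxef.trans (add_le_add (he'.le.trans hev)
            (hfz'.trans (nsmul_le_nsmul_right hzu 2)))
      _ ≤ ((k + 1) * (2 * (n'' + 1) + 2 * (n' + 1) + 1)) • v₀ +
          ((k + 1) * (2 * (n'' + 1) + 2 * (n' + 1) + 1)) • (u : S) := by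
        rw [← mul_nsmul']
        exact add_le_add (nsmul_mono_left _ (by nlinarith)) (nsmul_mono_left _ (by nlinarith))
      _ = _ := (nsmul_add _ _ _).symm

end CuIdeal

theorem theorem4p12 {S : Type*} [AddCommMonoid S] [PartialOrder S] [CuSemigroup S]
    (hO5 : AxiomO5 S) (hO6 : AxiomO6 S) (hO7 : AxiomO7 S) (hO8 : AxiomO8 S) (I : CuIdeal S) :
    (∃ m n : ℕ, IsPureMN S m n) ↔
      (∃ m' n' : ℕ, IsPureMN I.toAddSubmonoid m' n') ∧ (∃ m'' n'' : ℕ, IsPureMN I.Quot m'' n'') := by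
  constructor
  · rintro ⟨m, n, hm, hn⟩
    exact ⟨⟨m, n, I.hasComparison_coe hm, I.isAlmostDivisible_coe hn⟩,
      ⟨m, n, I.hasComparison_quot hm, I.isAlmostDivisible_quot hn⟩⟩
  · rintro ⟨⟨m', n', hm', hn'⟩, ⟨m'', n'', hm'', hn''⟩⟩
    exact ⟨_, _, I.hasComparison hO6 hO7 hm' hm'', I.isAlmostDivisible hO5 hO6 hO7 hO8 hn' hn''⟩
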